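/- **Setting.** Let $u:\mathbb R\to\mathbb R$ be convex and increasing (not necessarily strictly); then $u$ is continuously differentiable outside a countable set, and $u'$ denotes its derivative, extended to the exceptional points as the left derivative. Assume that $u'(x)<1<u'(y)$ for some $x,y\in\mathbb R$. Let $X$ be a real random variable on a probability space, and suppose that (A) $u$ is continuously differentiable on $\mathbb R$, or (B) the distribution function of $X$ is continuous. Whenever the expectations exist, put $$\mathrm{OCE}_u(X)=\inf_{t\in\mathbb R}\bigl\{t+\mathbb E[u(-X-t)]\bigr\}.$$ For $m\ge 1$ and $\mathbf z\in\mathbb R^m$ put $$\overline{\mathrm{SR}}_m(\mathbf z)=\min\Bigl\{t\in\mathbb R:\tfrac1m\sum_{j=1}^m u'(-z_j-t)\le 1\Bigr\},\qquad \mathrm{OCE}_m(\mathbf z)=\overline{\mathrm{SR}}_m(\mathbf z)+\tfrac1m\sum_{j=1}^m u\bigl(-z_j-\overline{\mathrm{SR}}_m(\mathbf z)\bigr).$$ Let $\mathbf Z=(Z_1,\dots,Z_m)$ be i.i.d. with the distribution of $X$. **Lemma.** Suppose moreover that $u$ is $L_2$-Lipschitz. 1. If $\|X\|_{L^q}\le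 T$ for some $q>2$ and $T>0$, then $$\mathbb E\bigl[\,|\mathrm{OCE}_m(\mathbf Z)-\mathrm{OCE}_u(X)|\,\bigr]\le \frac{39\,L_2T}{\sqrt m}.$$ 2. If $\|X\|_{L^q}\le T$ for some $q>4$ and $T>0$, then $$\mathbb E\bigl[\,|\mathrm{OCE}_m(\mathbf Z)-\mathrm{OCE}_u(X)|^2\,\bigr]\le \frac{108\,L_2^2T^2}{\sqrt m}.$$ In both cases the expectations on the left are finite. -/

import Mathlib

open MeasureTheory ProbabilityTheory Set Filter Topology
open scoped NNReal ENNReal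

namespace OCERisk

noncomputable section

/-- The derivative `u'` of a convex function `u : ℝ → ℝ`, in its left-continuous version: it is the
left derivative, which exists everywhere and is `deriv u x` wherever `u` is differentiable (all
but countably many points). -/
def du (u : ℝ → ℝ) (x : ℝ) : ℝ := derivWithin u (Iio x) x

/-- Utility functions: convex and (weakly) increasing, with `u'` taking values on both sides of `1`.
Convexity makes `u` continuously differentiable outside a countable set. -/
structure IsUtility (u : ℝ → ℝ) : Prop where
  convex : ConvexOn ℝ univ u
  mono : Monotone u
  exists_du_lt_one : ∃ x, du u x < 1
  exists_one_lt_du : ∃ x, 1 < du u x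

/-- The optimized certainty equivalent `inf_t { t + E[u(-X - t)] }`
(the infimum is finite, see `bddBelow_oce`). -/
def oce {Ω : Type*} [MeasurableSpace Ω] (u : ℝ → ℝ) (P : Measure Ω) (X : Ω → ℝ) : ℝ :=
  ⨅ t : ℝ, (t + ∫ ω, u (-X ω - t) ∂P)

/-- The sample average constraint set `{ t | (1/m) ∑ⱼ u'(-zⱼ - t) ≤ 1 }`. -/
def saaSet (u : ℝ → ℝ) {m : ℕ} (z : Fin m → ℝ) : Set ℝ :=
  {t : ℝ | (1 / (m : ℝ)) * ∑ j, du u (-z j - t) ≤ 1}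

/-- The estimator `min { t | (1/m) ∑ⱼ u'(-zⱼ - t) ≤ 1 }`
(the minimum is attained, see `isLeast_saaSR`). -/
def saaSR (u : ℝ → ℝ) {m : ℕ} (z : Fin m → ℝ) : ℝ := sInf (saaSet u z)

/-- The SAA estimator of the optimized certainty equivalent. -/
def saaOCE (u : ℝ → ℝ) {m : ℕ} (z : Fin m → ℝ) : ℝ :=
  saaSR u z + (1 / (m : ℝ)) * ∑ j, u (-z j - saaSR u z)

theorem du_mono {u : ℝ → ℝ} (hu : ConvexOn ℝ univ u) : Monotone (du u) := by
  intro x y hxy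
  have h := hu.monotoneOn_leftDeriv
  rw [interior_univ] at h
  exact h (mem_univ x) (mem_univ y) hxy

theorem slope_le_du {u : ℝ → ℝ} (hu : ConvexOn ℝ univ u) {x y : ℝ} (h : x < y) :
    slope u x y ≤ du u y :=
  hu.slope_le_leftDeriv_of_mem_interior (mem_univ x) (by simp) h

theorem tendsto_du_left {u : ℝ → ℝ} (hu : ConvexOn ℝ univ u) (x : ℝ) :
    Tendsto (du u) (𝓝[<] x) (𝓝 (du u x)) := by
  have hcont : Continuous u := by
    have h := hu.continuousOn_interior
    rw [interior_univ] at h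
    exact continuousOn_univ.1 h
  rw [tendsto_order]
  constructor
  · intro c hc
    have hd : HasDerivWithinAt u (du u x) (Iio x) x :=
      hu.hasDerivWithinAt_leftDeriv_of_mem_interior (by simp)
    rw [hasDerivWithinAt_iff_tendsto_slope' (by simp)] at hd
    obtain ⟨y, hy, hyx⟩ := ((hd.eventually (lt_mem_nhds hc)).and self_mem_nhdsWithin).exists
    have hyx' : y < x := hyx
    have hsl : Tendsto (fun w => slope u y w) (𝓝[<] x) (𝓝 (slope u y x)) := by
      have hw : ContinuousAt (fun w => slope u y w) x := by
        simp only [slope_def_field]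
        exact (hcont.continuousAt.sub continuousAt_const).div
          (continuousAt_id.sub continuousAt_const) (sub_ne_zero.2 hyx'.ne')
      exact hw.tendsto.mono_left nhdsWithin_le_nhds
    rw [slope_comm] at hy
    have hmem : ∀ᶠ w in 𝓝[<] x, y < w := nhdsWithin_le_nhds (lt_mem_nhds hyx')
    filter_upwards [hsl.eventually (lt_mem_nhds hy), hmem] with w h1 h2
    exact h1.trans_le (slope_le_du hu h2)
  · intro c hc
    filter_upwards [self_mem_nhdsWithin] with w hw
    exact (du_mono hu (le_of_lt hw)).trans_lt hc

/-- For a utility function and at least one sample the minimum defining `saaSR` is attained. -/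
theorem isLeast_saaSR {u : ℝ → ℝ} (hu : IsUtility u) {m : ℕ} (hm : 0 < m) (z : Fin m → ℝ) :
    IsLeast (saaSet u z) (saaSR u z) := by
  have hm' : (0 : ℝ) < m := by exact_mod_cast hm
  have : Nonempty (Fin m) := ⟨⟨0, hm⟩⟩
  have hanti : Antitone (fun t : ℝ => (1 / (m : ℝ)) * ∑ j, du u (-z j - t)) := by
    intro s t hst
    refine mul_le_mul_of_nonneg_left (Finset.sum_le_sum fun j _ => ?_) (by positivity)
    exact du_mono hu.convex (by linarith)
  obtain ⟨a, ha⟩ := hu.exists_du_lt_one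
  obtain ⟨b, hb⟩ := hu.exists_one_lt_du
  obtain ⟨B, hB⟩ := (Set.finite_range z).bddAbove
  obtain ⟨A, hA⟩ := (Set.finite_range z).bddBelow
  have hne : (saaSet u z).Nonempty := by
    refine ⟨-A - a, ?_⟩
    have h : ∑ j, du u (-z j - (-A - a)) ≤ ∑ _j : Fin m, (1 : ℝ) := by
      refine Finset.sum_le_sum fun j _ => le_trans (du_mono hu.convex ?_) ha.le
      have := hA (mem_range_self j)
      linarith
    simp only [Finset.sum_const, Finset.card_univ, Fintype.card_fin, nsmul_eq_mul, mul_one] at h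
    change (1 / (m : ℝ)) * _ ≤ 1
    rw [one_div, inv_mul_le_iff₀ hm', mul_one]
    exact h
  have hbdd : BddBelow (saaSet u z) := by
    refine ⟨-B - b, fun t ht => ?_⟩
    by_contra hlt
    push Not at hlt
    have h : ∑ _j : Fin m, (1 : ℝ) < ∑ j, du u (-z j - t) := by
      refine Finset.sum_lt_sum_of_nonempty Finset.univ_nonempty fun j _ =>
        lt_of_lt_of_le hb (du_mono hu.convex ?_)
      have := hB (mem_range_self j)
      linarith
    simp only [Finset.sum_const, Finset.card_univ, Fintype.card_fin, nsmul_eq_mul, mul_one] at h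
    change (1 / (m : ℝ)) * _ ≤ 1 at ht
    rw [one_div, inv_mul_le_iff₀ hm', mul_one] at ht
    linarith
  refine ⟨?_, fun t ht => csInf_le hbdd ht⟩
  have hlim : Tendsto (fun t : ℝ => (1 / (m : ℝ)) * ∑ j, du u (-z j - t)) (𝓝[>] (saaSR u z))
      (𝓝 ((1 / (m : ℝ)) * ∑ j, du u (-z j - saaSR u z))) := by
    refine Tendsto.const_mul _ (tendsto_finsetSum _ fun j _ => ?_)
    refine (tendsto_du_left hu.convex _).comp ?_
    refine tendsto_nhdsWithin_iff.2 ⟨?_, ?_⟩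
    · exact (tendsto_const_nhds.sub tendsto_id).mono_left nhdsWithin_le_nhds
    · filter_upwards [self_mem_nhdsWithin] with t ht
      have : saaSR u z < t := ht
      simp only [mem_Iio]
      linarith
  refine le_of_tendsto hlim ?_
  filter_upwards [self_mem_nhdsWithin] with t ht
  obtain ⟨s, hs, hst⟩ := exists_lt_of_csInf_lt hne ht
  exact (hanti hst.le).trans hs

theorem du_supports {u : ℝ → ℝ} (hu : ConvexOn ℝ univ u) (x y : ℝ) :
    u x + du u x * (y - x) ≤ u y := by
  rcases lt_trichotomy y x with h | h | h
  · have hs := slope_le_du hu h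
    rw [slope_def_field, div_le_iff₀ (by linarith)] at hs
    nlinarith
  · simp [h]
  · have h1 : du u x ≤ derivWithin u (Ioi x) x :=
      hu.leftDeriv_le_rightDeriv_of_mem_interior (by simp)
    have h2 := h1.trans (hu.rightDeriv_le_slope_of_mem_interior (by simp) (mem_univ y) h)
    rw [slope_def_field, le_div_iff₀ (by linarith)] at h2
    linarith

/-- For a utility function and an integrable `X` such that `u(-X - t)` is integrable for every `t`,
the infimum defining `oce` is over a set that is bounded below. -/
theorem bddBelow_oce {Ω : Type*} [MeasurableSpace Ω] {u : ℝ → ℝ} (hu : IsUtility u)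
    (P : Measure Ω) [IsProbabilityMeasure P] {X : Ω → ℝ} (hX : Integrable X P)
    (hint : ∀ t : ℝ, Integrable (fun ω => u (-X ω - t)) P) :
    BddBelow (range fun t : ℝ => t + ∫ ω, u (-X ω - t) ∂P) := by
  have key : ∀ x t : ℝ, u x + du u x * (-(∫ ω, X ω ∂P) - t - x) ≤ ∫ ω, u (-X ω - t) ∂P := by
    intro x t
    have hi : Integrable (fun ω => (u x + du u x * (-t - x)) + (-du u x) * X ω) P :=
      (integrable_const _).add (hX.const_mul _)
    have h := integral_mono hi (hint t) fun ω => by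
      have := du_supports hu.convex x (-X ω - t)
      change _ + _ * X ω ≤ u (-X ω - t)
      linarith
    rw [integral_add (integrable_const _) (hX.const_mul _), integral_const_mul] at h
    simp only [integral_const, probReal_univ, one_smul] at h
    linarith
  obtain ⟨a, ha⟩ := hu.exists_du_lt_one
  obtain ⟨b, hb⟩ := hu.exists_one_lt_du
  refine ⟨min (u a + du u a * (-(∫ ω, X ω ∂P) - a)) (u b + du u b * (-(∫ ω, X ω ∂P) - b)), ?_⟩
  rintro _ ⟨t, rfl⟩
  rcases le_total 0 t with ht | ht
  · have := key a t
    refine (min_le_left _ _).trans ?_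
    change _ ≤ t + ∫ ω, u (-X ω - t) ∂P
    nlinarith
  · have := key b t
    refine (min_le_right _ _).trans ?_
    change _ ≤ t + ∫ ω, u (-X ω - t) ∂P
    nlinarith

end

end OCERisk

namespace OCERisk

/-! The sample estimator is the minimum over `t` of the sample average objective (`saaOCE_le`), and
a solution `t` of E[u'(-X-t)] = 1 minimizes the population objective. Under (A) or (B) such a `t`
exists by continuity. Fix it. The error is then at most the fluctuation of the sample objective at
this fixed `t`, a centered sample average with mean square at most L²T²/m, plus the suboptimality
gap of `t` in the sample problem.

For the gap, let b and a be the sample averages of the positive and negative parts of u'(-x-t) - 1.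
Both have the same mean α. Convexity, used between `t` and the sample optimizer and between `t` and
a minimizer y₀ of u(y) - y, bounds the gap by |b-a||t+y₀| + 2√(L S)|√b-√a|, where S is the sample
second moment (`sample_gap_le`). No curvature of u is needed.

Both terms are controlled uniformly in α. The variance of b - a is at most Lα/m, while α(t+y₀)² ≤
LT², because one of the two parts lives where |x| ≥ |t+y₀|. Square roots absorb the possible
smallness of α: (√b-√α)² ≤ (b-α)²/α has mean O(L/m), since the variance of b is itself proportional
to α. A weighted AM-GM inequality then gives the rate 1/√m for the first moment. For the second
moment, (√b-√a)² ≤ |b-a| and fourth moments give 1/√m for the squared error. -/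

/-! ### The deterministic sample problem -/

theorem du_nonneg {u : ℝ → ℝ} (hu : IsUtility u) (x : ℝ) : 0 ≤ du u x := by
  have h1 := du_supports hu.convex x (x - 1)
  have h2 : u (x - 1) ≤ u x := hu.mono (by linarith)
  linarith

theorem abs_sub_le_of_lipschitz {u : ℝ → ℝ} {L : ℝ≥0} (hLip : LipschitzWith L u) (x y : ℝ) :
    |u x - u y| ≤ L * |x - y| := by
  have := hLip.dist_le_mul x y
  rwa [Real.dist_eq, Real.dist_eq] at this

theorem du_le_of_lipschitz {u : ℝ → ℝ} (hu : IsUtility u) {L : ℝ≥0} (hLip : LipschitzWith L u)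
    (x : ℝ) : du u x ≤ L := by
  have h1 := du_supports hu.convex x (x + 1)
  have h2 := (le_abs_self _).trans (abs_sub_le_of_lipschitz hLip (x + 1) x)
  simp only [add_sub_cancel_left, abs_one, mul_one] at h1 h2
  linarith

theorem one_lt_lipschitz_const {u : ℝ → ℝ} (hu : IsUtility u) {L : ℝ≥0}
    (hLip : LipschitzWith L u) : (1 : ℝ) < L := by
  obtain ⟨y, hy⟩ := hu.exists_one_lt_du
  exact hy.trans_le (du_le_of_lipschitz hu hLip y)

theorem IsUtility.continuous {u : ℝ → ℝ} (hu : IsUtility u) : Continuous u := by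
  have h := hu.convex.continuousOn_interior
  rw [interior_univ] at h
  exact continuousOn_univ.1 h

/-- The SAA estimator is the minimum of the sample average objective. -/
theorem saaOCE_le {u : ℝ → ℝ} (hu : IsUtility u) {m : ℕ} (hm : 0 < m) (z : Fin m → ℝ) (t : ℝ) :
    saaOCE u z ≤ t + (1 / (m : ℝ)) * ∑ j, u (-z j - t) := by
  have hm' : (0 : ℝ) < m := by exact_mod_cast hm
  have hleast := isLeast_saaSR hu hm z
  have key : ∀ r t : ℝ, (1 / (m : ℝ)) * ∑ j, u (-z j - r)
      + (r - t) * ((1 / (m : ℝ)) * ∑ j, du u (-z j - r)) ≤ (1 / (m : ℝ)) * ∑ j, u (-z j - t) := by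
    intro r t
    have h : ∑ j, (u (-z j - r) + (r - t) * du u (-z j - r)) ≤ ∑ j, u (-z j - t) :=
      Finset.sum_le_sum fun j _ => by
        have := du_supports hu.convex (-z j - r) (-z j - t)
        linarith
    rw [Finset.sum_add_distrib, ← Finset.mul_sum] at h
    have h' := mul_le_mul_of_nonneg_left h (by positivity : 0 ≤ 1 / (m : ℝ))
    linarith
  rcases le_or_gt (saaSR u z) t with h | h
  · have h1 := key (saaSR u z) t
    have h2 : (1 / (m : ℝ)) * ∑ j, du u (-z j - saaSR u z) ≤ 1 := hleast.1
    unfold saaOCE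
    nlinarith
  -- The left derivative gives only a one-sided condition at the minimum, so the tangent inequality
  -- is applied at r slightly to its left, where the mean slope exceeds 1, and r is sent to the
  -- minimum.
  · have hc : Continuous fun r : ℝ => r + (1 / (m : ℝ)) * ∑ j, u (-z j - r) := by
      have := hu.continuous
      fun_prop
    have hlim : Tendsto (fun r : ℝ => r + (1 / (m : ℝ)) * ∑ j, u (-z j - r)) (𝓝[<] (saaSR u z))
        (𝓝 (saaOCE u z)) := (hc.tendsto _).mono_left nhdsWithin_le_nhds
    refine le_of_tendsto hlim ?_
    have hmem : ∀ᶠ w in 𝓝[<] (saaSR u z), t < w := nhdsWithin_le_nhds (lt_mem_nhds h)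
    filter_upwards [self_mem_nhdsWithin, hmem] with r hr htr
    have h1 := key r t
    have h2 : 1 < (1 / (m : ℝ)) * ∑ j, du u (-z j - r) := by
      by_contra hn
      exact absurd (hleast.2 (not_lt.1 hn : r ∈ saaSet u z)) (not_le.2 hr)
    nlinarith

/-- Optimality of the sample estimator for the single sample 0 is exactly minimality of u(y) - y at
the negated optimizer. The point y₀ separates the region u' > 1 from the region u' < 1. -/
theorem exists_minimizer {u : ℝ → ℝ} (hu : IsUtility u) :
    ∃ y₀ : ℝ, (∀ y, u y₀ - y₀ ≤ u y - y) ∧ (∀ y, 1 < du u y → y₀ < y) ∧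
      (∀ y, du u y < 1 → y ≤ y₀) := by
  have hmin : ∀ y, u (-saaSR u (0 : Fin 1 → ℝ)) - -saaSR u (0 : Fin 1 → ℝ) ≤ u y - y := by
    intro y
    have h := saaOCE_le hu one_pos (0 : Fin 1 → ℝ) (-y)
    simp [saaOCE] at h
    linarith
  refine ⟨-saaSR u (0 : Fin 1 → ℝ), hmin, fun y hy => ?_, fun y hy => ?_⟩
  · by_contra hn
    have h1 : saaSR u (0 : Fin 1 → ℝ) ∈ saaSet u (0 : Fin 1 → ℝ) := (isLeast_saaSR hu one_pos _).1
    simp [saaSet] at h1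
    exact absurd ((du_mono hu.convex (not_lt.1 hn)).trans h1) (not_le.2 hy)
  · by_contra hn
    have h1 := du_supports hu.convex y (-saaSR u (0 : Fin 1 → ℝ))
    have h2 := hmin y
    nlinarith

/-- Inserting the optimizer for w into the problem for z shows that the value is L-Lipschitz in the
sup metric. This yields measurability of the estimator without any regularity of the optimizer
itself. -/
theorem continuous_saaOCE {u : ℝ → ℝ} (hu : IsUtility u) {L : ℝ≥0} (hLip : LipschitzWith L u)
    {m : ℕ} (hm : 0 < m) : Continuous fun z : Fin m → ℝ => saaOCE u z := by
  have hm' : (0 : ℝ) < m := by exact_mod_cast hm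
  refine (LipschitzWith.of_le_add_mul L fun z w => ?_).continuous
  have h1 := saaOCE_le hu hm z (saaSR u w)
  have h2 : ∑ j, u (-z j - saaSR u w) ≤ ∑ j, (u (-w j - saaSR u w) + L * dist z w) := by
    refine Finset.sum_le_sum fun j _ => ?_
    have h3 := (le_abs_self _).trans
      (abs_sub_le_of_lipschitz hLip (-z j - saaSR u w) (-w j - saaSR u w))
    have h4 : |(-z j - saaSR u w) - (-w j - saaSR u w)| ≤ dist z w := by
      rw [show (-z j - saaSR u w) - (-w j - saaSR u w) = -(z j - w j) by ring, abs_neg,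
        ← Real.dist_eq]
      exact dist_le_pi_dist z w j
    have h5 := mul_le_mul_of_nonneg_left h4 L.coe_nonneg
    linarith
  rw [Finset.sum_add_distrib] at h2
  simp only [Finset.sum_const, Finset.card_univ, Fintype.card_fin, nsmul_eq_mul] at h2
  have h6 := mul_le_mul_of_nonneg_left h2 (by positivity : 0 ≤ 1 / (m : ℝ))
  have h7 : 1 / (m : ℝ) * (m * (L * dist z w)) = L * dist z w := by field_simp
  rw [mul_add, h7] at h6
  change saaOCE u z ≤ saaSR u w + (1 / (m : ℝ)) * ∑ j, u (-w j - saaSR u w) + L * dist z w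
  linarith

/-! ### Sample averages and the suboptimality gap -/

/-- The sample average of `f` over `z`. -/
noncomputable def avg {m : ℕ} (f : ℝ → ℝ) (z : Fin m → ℝ) : ℝ := (1 / (m : ℝ)) * ∑ j, f (z j)

theorem avg_mono {m : ℕ} {f g : ℝ → ℝ} (h : ∀ x, f x ≤ g x) (z : Fin m → ℝ) :
    avg f z ≤ avg g z :=
  mul_le_mul_of_nonneg_left (Finset.sum_le_sum fun j _ => h (z j)) (by positivity)

theorem avg_nonneg {m : ℕ} {f : ℝ → ℝ} (h : ∀ x, 0 ≤ f x) (z : Fin m → ℝ) : 0 ≤ avg f z :=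
  mul_nonneg (by positivity) (Finset.sum_nonneg fun j _ => h (z j))

theorem avg_add {m : ℕ} (f g : ℝ → ℝ) (z : Fin m → ℝ) :
    avg (fun x => f x + g x) z = avg f z + avg g z := by
  simp only [avg, Finset.sum_add_distrib, mul_add]

theorem avg_sub {m : ℕ} (f g : ℝ → ℝ) (z : Fin m → ℝ) :
    avg (fun x => f x - g x) z = avg f z - avg g z := by
  simp only [avg, Finset.sum_sub_distrib, mul_sub]

theorem avg_const_mul {m : ℕ} (c : ℝ) (f : ℝ → ℝ) (z : Fin m → ℝ) :
    avg (fun x => c * f x) z = c * avg f z := by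
  simp only [avg, ← Finset.mul_sum]; ring

theorem avg_const {m : ℕ} (hm : 0 < m) (c : ℝ) (z : Fin m → ℝ) : avg (fun _ => c) z = c := by
  have hm' : (0 : ℝ) < m := by exact_mod_cast hm
  simp only [avg, Finset.sum_const, Finset.card_univ, Fintype.card_fin, nsmul_eq_mul]
  field_simp

theorem avg_mul_sq_le {m : ℕ} (f g : ℝ → ℝ) (z : Fin m → ℝ) :
    avg (fun x => f x * g x) z ^ 2 ≤ avg (fun x => f x ^ 2) z * avg (fun x => g x ^ 2) z := by
  have h := Finset.sum_mul_sq_le_sq_mul_sq Finset.univ (fun j => f (z j)) (fun j => g (z j))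
  have h' := mul_le_mul_of_nonneg_left h (by positivity : 0 ≤ (1 / (m : ℝ)) ^ 2)
  simp only [avg]
  linarith

/-- Combining a bound that is linear in the shift `τ` with one that trades it off. -/
theorem gap_bound {v a b K s τ : ℝ} (ha : 0 ≤ a) (hab : a < b)
    (h1 : v ≤ (b - a) * τ) (h2 : v ≤ √b * K + b * s - a * τ) (hK : 0 ≤ K) :
    v ≤ (b - a) * s + 2 * K * |√b - √a| := by
  have hb : 0 < b := ha.trans_lt hab
  -- Weights a on the first bound and b - a on the second cancel τ.
  have h3 : b * v ≤ (b - a) * (√b * K + b * s) := by nlinarith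
  have hrb : 0 < √b := Real.sqrt_pos.2 hb
  have hra : 0 ≤ √a := Real.sqrt_nonneg a
  have hle : √a ≤ √b := Real.sqrt_le_sqrt hab.le
  rw [abs_of_nonneg (by linarith)]
  have h4 : b - a = (√b - √a) * (√b + √a) := by
    have e1 := Real.sq_sqrt ha
    have e2 := Real.sq_sqrt hb.le
    linarith
  have h5 : (b - a) * √b ≤ 2 * b * (√b - √a) := by
    have e2 := Real.sq_sqrt hb.le
    nlinarith [mul_nonneg (mul_nonneg (sub_nonneg.2 hle) (sub_nonneg.2 hle)) hrb.le]
  have h6 : b * v ≤ b * ((b - a) * s + 2 * K * (√b - √a)) := by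
    nlinarith [mul_le_mul_of_nonneg_left h5 hK]
  exact le_of_mul_le_mul_left h6 hb

/-- Excess of the derivative over `1`, as a function of the sample. -/
noncomputable def excess (u : ℝ → ℝ) (t x : ℝ) : ℝ := max (du u (-x - t) - 1) 0

/-- Deficit of the derivative below `1`, as a function of the sample. -/
noncomputable def deficit (u : ℝ → ℝ) (t x : ℝ) : ℝ := max (1 - du u (-x - t)) 0

theorem excess_nonneg (u : ℝ → ℝ) (t x : ℝ) : 0 ≤ excess u t x := le_max_right _ _

theorem deficit_nonneg (u : ℝ → ℝ) (t x : ℝ) : 0 ≤ deficit u t x := le_max_right _ _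

theorem excess_sub_deficit (u : ℝ → ℝ) (t x : ℝ) :
    excess u t x - deficit u t x = du u (-x - t) - 1 := by
  unfold excess deficit
  rcases le_total (du u (-x - t)) 1 with h | h
  · rw [max_eq_right (by linarith), max_eq_left (by linarith)]; ring
  · rw [max_eq_left (by linarith), max_eq_right (by linarith)]; ring

/-- Since 0 ≤ u' ≤ L, the excess lies in [0, L-1]. Bounding squares linearly is what makes variances
proportional to the mean. -/
theorem excess_sq_le {u : ℝ → ℝ} (hu : IsUtility u) {L : ℝ≥0} (hLip : LipschitzWith L u)
    (t x : ℝ) : excess u t x ^ 2 ≤ (L - 1) * excess u t x := by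
  have h1 := excess_nonneg u t x
  have h2 : excess u t x ≤ L - 1 :=
    max_le (by linarith [du_le_of_lipschitz hu hLip (-x - t)])
      (by linarith [one_lt_lipschitz_const hu hLip])
  nlinarith

theorem deficit_sq_le {u : ℝ → ℝ} (hu : IsUtility u) (t x : ℝ) :
    deficit u t x ^ 2 ≤ deficit u t x := by
  have h1 := deficit_nonneg u t x
  have h2 : deficit u t x ≤ 1 := max_le (by linarith [du_nonneg hu (-x - t)]) zero_le_one
  nlinarith

/-- The suboptimality of `t` for the sample average problem. -/
theorem sample_gap_le {u : ℝ → ℝ} (hu : IsUtility u) {L : ℝ≥0} (hLip : LipschitzWith L u)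
    {y₀ : ℝ} (hmin : ∀ y, u y₀ - y₀ ≤ u y - y) {m : ℕ} (hm : 0 < m) (z : Fin m → ℝ) (t : ℝ) :
    t + avg (fun x => u (-x - t)) z - saaOCE u z ≤
      |avg (excess u t) z - avg (deficit u t) z| * |t + y₀|
      + 2 * (√L * √(avg (fun x => x ^ 2) z))
        * |√(avg (excess u t) z) - √(avg (deficit u t) z)| := by
  have hL := one_lt_lipschitz_const hu hLip
  set r := saaSR u z with hr
  set τ := r - t with hτ
  set b := avg (excess u t) z with hb
  set a := avg (deficit u t) z with ha
  set S := avg (fun x => x ^ 2) z with hS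
  have hb0 : 0 ≤ b := avg_nonneg (excess_nonneg u t) z
  have ha0 : 0 ≤ a := avg_nonneg (deficit_nonneg u t) z
  have hS0 : 0 ≤ S := avg_nonneg (fun x => sq_nonneg x) z
  set h : ℝ → ℝ := fun x => u (-x - t) - u (-x - r) - τ with hh
  have hv : t + avg (fun x => u (-x - t)) z - saaOCE u z = avg h z := by
    have : saaOCE u z = r + avg (fun x => u (-x - r)) z := rfl
    rw [this, hh, avg_sub, avg_sub, avg_const hm]
    ring
  have hlin : ∀ x, h x ≤ (excess u t x - deficit u t x) * τ := by
    intro x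
    rw [excess_sub_deficit]
    have := du_supports hu.convex (-x - t) (-x - r)
    simp only [hh, hτ]
    nlinarith
  -- The tangent at -x-t is evaluated at y₀, and minimality of u(y) - y at y₀ removes the dependence
  -- on r.
  have hy : ∀ x, h x ≤ (excess u t x - deficit u t x) * (-x - (t + y₀)) := by
    intro x
    rw [excess_sub_deficit]
    have h1 := du_supports hu.convex (-x - t) y₀
    have h2 := hmin (-x - r)
    simp only [hh, hτ]
    nlinarith
  clear_value h
  have hv1 : avg h z ≤ (b - a) * τ := by
    have := avg_mono hlin z
    rwa [show (fun x => (excess u t x - deficit u t x) * τ)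
      = fun x => τ * (excess u t x - deficit u t x) by funext x; ring, avg_const_mul, avg_sub,
      mul_comm] at this
  -- Cauchy-Schwarz, with the square of f traded for L times f.
  have hsq : ∀ (f : ℝ → ℝ), (∀ x, 0 ≤ f x) → (∀ x, f x ^ 2 ≤ L * f x) →
      avg (fun x => f x * |x|) z ≤ √(avg f z) * (√L * √S) := by
    intro f hf0 hf
    have h1 := avg_mul_sq_le f (fun x => |x|) z
    simp only [sq_abs] at h1
    have h2 : avg (fun x => f x ^ 2) z ≤ L * avg f z := by
      rw [← avg_const_mul]; exact avg_mono hf z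
    rw [← Real.sqrt_mul L.coe_nonneg, ← Real.sqrt_mul (avg_nonneg hf0 z)]
    refine Real.le_sqrt_of_sq_le ?_
    nlinarith
  rw [hv]
  rcases lt_trichotomy a b with hab | hab | hab
  · rw [abs_of_pos (sub_pos.2 hab)]
    refine gap_bound ha0 hab hv1 ?_ (by positivity)
    -- The bound through y₀ is used where u' ≥ 1 and the bound through τ where u' ≤ 1. The averaged
    -- result is the second input of `gap_bound`; for b < a the roles are exchanged and τ changes
    -- sign.
    have h1 : ∀ x, h x ≤ excess u t x * |x| + |t + y₀| * excess u t x - τ * deficit u t x := by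
      intro x
      rcases le_total (du u (-x - t)) 1 with hd | hd
      · have h0 : excess u t x = 0 := max_eq_right (by linarith)
        have := hlin x
        rw [h0] at this ⊢
        linarith
      · have h0 : deficit u t x = 0 := max_eq_right (by linarith)
        have := hy x
        rw [h0] at this ⊢
        nlinarith [excess_nonneg u t x, neg_abs_le x, neg_abs_le (t + y₀)]
    have h2 := avg_mono h1 z
    rw [avg_sub, avg_add, avg_const_mul, avg_const_mul] at h2
    have h3 := hsq _ (excess_nonneg u t) fun x => (excess_sq_le hu hLip t x).trans
      (by nlinarith [excess_nonneg u t x])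
    linarith
  · rw [hab] at hv1 ⊢
    simp only [sub_self, zero_mul, abs_zero, mul_zero, add_zero] at hv1 ⊢
    exact hv1
  · rw [abs_of_neg (sub_neg.2 hab), abs_sub_comm, neg_sub]
    refine gap_bound (τ := -τ) hb0 hab (by linarith) ?_ (by positivity)
    have h1 : ∀ x, h x ≤ deficit u t x * |x| + |t + y₀| * deficit u t x - (-τ) * excess u t x := by
      intro x
      rcases le_total (du u (-x - t)) 1 with hd | hd
      · have h0 : excess u t x = 0 := max_eq_right (by linarith)
        have := hy x
        rw [h0] at this ⊢
        nlinarith [deficit_nonneg u t x, le_abs_self x, le_abs_self (t + y₀)]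
      · have h0 : deficit u t x = 0 := max_eq_right (by linarith)
        have := hlin x
        rw [h0] at this ⊢
        linarith
    have h2 := avg_mono h1 z
    rw [avg_sub, avg_add, avg_const_mul, avg_const_mul] at h2
    have h3 := hsq _ (deficit_nonneg u t) fun x => (deficit_sq_le hu t x).trans
      (by nlinarith [deficit_nonneg u t x])
    linarith

/-- A positive excess forces -x-t > y₀, hence -x > t+y₀ ≥ 0 and x² ≥ (t+y₀)². -/
theorem excess_mul_sq_le {u : ℝ → ℝ} (hu : IsUtility u) {L : ℝ≥0} (hLip : LipschitzWith L u)
    {y₀ t : ℝ} (hy : ∀ y, 1 < du u y → y₀ < y) (hs : 0 ≤ t + y₀) (x : ℝ) :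
    excess u t x * (t + y₀) ^ 2 ≤ L * x ^ 2 := by
  rcases le_or_gt (du u (-x - t)) 1 with hd | hd
  · have h0 : excess u t x = 0 := max_eq_right (by linarith)
    rw [h0, zero_mul]; positivity
  · have h1 := hy _ hd
    have h2 : excess u t x ≤ L :=
      max_le (by linarith [du_le_of_lipschitz hu hLip (-x - t)]) L.coe_nonneg
    exact mul_le_mul h2 (by nlinarith) (sq_nonneg _) L.coe_nonneg

theorem deficit_mul_sq_le {u : ℝ → ℝ} (hu : IsUtility u) {L : ℝ≥0} (hLip : LipschitzWith L u)
    {y₀ t : ℝ} (hy : ∀ y, du u y < 1 → y ≤ y₀) (hs : t + y₀ ≤ 0) (x : ℝ) :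
    deficit u t x * (t + y₀) ^ 2 ≤ L * x ^ 2 := by
  have hL := one_lt_lipschitz_const hu hLip
  rcases le_or_gt 1 (du u (-x - t)) with hd | hd
  · have h0 : deficit u t x = 0 := max_eq_right (by linarith)
    rw [h0, zero_mul]; positivity
  · have h1 := hy _ hd
    have h2 : deficit u t x ≤ L :=
      max_le (by linarith [du_nonneg hu (-x - t)]) L.coe_nonneg
    exact mul_le_mul h2 (by nlinarith) (sq_nonneg _) L.coe_nonneg

end OCERisk

namespace OCERisk

/-! ### The population problem and its first order condition -/

variable {Ω : Type*} [MeasurableSpace Ω] {P : Measure Ω}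

theorem measure_singleton_eq_zero_of_continuous_cdf (μ : Measure ℝ) [IsProbabilityMeasure μ]
    (h : Continuous (cdf μ)) (x : ℝ) : μ {x} = 0 := by
  rw [← measure_cdf (μ := μ), StieltjesFunction.measure_singleton, h.continuousAt.continuousWithinAt.leftLim_eq]
  simp

/-- In case (A) the left derivative is the continuous derivative. In case (B) it is monotone, so its
discontinuities form a countable set, which is null for an atomless law. -/
theorem ae_continuousAt_du [IsProbabilityMeasure P] {u : ℝ → ℝ} (hu : IsUtility u) {X : Ω → ℝ}
    (hX : AEMeasurable X P) (hreg : ContDiff ℝ 1 u ∨ Continuous (cdf (P.map X))) (t : ℝ) :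
    ∀ᵐ ω ∂P, ContinuousAt (du u) (-X ω - t) := by
  rcases hreg with h | h
  · have hd : du u = deriv u := by
      funext x
      exact (h.differentiable one_ne_zero x).derivWithin (uniqueDiffWithinAt_Iio x)
    rw [hd]
    exact Eventually.of_forall fun ω => (h.continuous_deriv le_rfl).continuousAt
  · have hp : IsProbabilityMeasure (P.map X) := Measure.isProbabilityMeasure_map hX
    have hc := (du_mono hu.convex).countable_not_continuousAt
    have hc' : {x | ¬ ContinuousAt (du u) (-x - t)}.Countable :=
      hc.preimage_of_injOn (f := fun x => -x - t) fun x _ y _ hxy => by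
        simpa using hxy
    have h0 : ∀ᵐ x ∂(P.map X), ContinuousAt (du u) (-x - t) := by
      rw [ae_iff]
      exact (measure_null_iff_singleton hc').2 fun x _ =>
        measure_singleton_eq_zero_of_continuous_cdf _ h x
    exact ae_of_ae_map hX h0

theorem measurable_du {u : ℝ → ℝ} (hu : IsUtility u) : Measurable (du u) :=
  (du_mono hu.convex).measurable

theorem norm_du_le {u : ℝ → ℝ} (hu : IsUtility u) {L : ℝ≥0} (hLip : LipschitzWith L u) (x : ℝ) :
    ‖du u x‖ ≤ L := by
  rw [Real.norm_of_nonneg (du_nonneg hu x)]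
  exact du_le_of_lipschitz hu hLip x

theorem aestronglyMeasurable_du {u : ℝ → ℝ} (hu : IsUtility u) {X : Ω → ℝ}
    (hX : AEMeasurable X P) (t : ℝ) : AEStronglyMeasurable (fun ω => du u (-X ω - t)) P :=
  ((measurable_du hu).comp_aemeasurable (hX.neg.sub_const t)).aestronglyMeasurable

theorem integrable_du [IsProbabilityMeasure P] {u : ℝ → ℝ} (hu : IsUtility u) {L : ℝ≥0}
    (hLip : LipschitzWith L u) {X : Ω → ℝ} (hX : AEMeasurable X P) (t : ℝ) :
    Integrable (fun ω => du u (-X ω - t)) P :=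
  Integrable.of_bound (aestronglyMeasurable_du hu hX t) L
    (Eventually.of_forall fun _ => norm_du_le hu hLip _)

/-- The first order condition for the optimal shift is solvable. -/
theorem exists_integral_du_eq_one [IsProbabilityMeasure P] {u : ℝ → ℝ} (hu : IsUtility u)
    {L : ℝ≥0} (hLip : LipschitzWith L u) {X : Ω → ℝ} (hX : AEMeasurable X P)
    (hreg : ContDiff ℝ 1 u ∨ Continuous (cdf (P.map X))) :
    ∃ t : ℝ, ∫ ω, du u (-X ω - t) ∂P = 1 := by
  have hcont : Continuous fun t : ℝ => ∫ ω, du u (-X ω - t) ∂P := by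
    refine continuous_iff_continuousAt.2 fun t => ?_
    refine tendsto_integral_filter_of_dominated_convergence (fun _ => (L : ℝ))
      (Eventually.of_forall fun s => aestronglyMeasurable_du hu hX s)
      (Eventually.of_forall fun s => Eventually.of_forall fun _ => norm_du_le hu hLip _)
      (integrable_const _) ?_
    filter_upwards [ae_continuousAt_du hu hX hreg t] with ω hω
    exact hω.tendsto.comp ((continuous_const.sub continuous_id).tendsto t)
  have hbb : BddBelow (range (du u)) := ⟨0, by rintro _ ⟨x, rfl⟩; exact du_nonneg hu x⟩
  have hba : BddAbove (range (du u)) :=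
    ⟨L, by rintro _ ⟨x, rfl⟩; exact du_le_of_lipschitz hu hLip x⟩
  -- As t tends to ±∞ the mean slope tends to the infimum or supremum of u', which lie strictly on
  -- either side of 1; the intermediate value theorem then applies.
  have lim : ∀ (l l' : Filter ℝ) [l.IsCountablyGenerated] (c : ℝ), Tendsto (du u) l' (𝓝 c) →
      (∀ x : ℝ, Tendsto (fun t : ℝ => -x - t) l l') →
      Tendsto (fun t : ℝ => ∫ ω, du u (-X ω - t) ∂P) l (𝓝 c) := by
    intro l l' _ c hc hl
    have := tendsto_integral_filter_of_dominated_convergence (μ := P) (l := l)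
      (F := fun (t : ℝ) ω => du u (-X ω - t)) (f := fun _ => c) (fun _ => (L : ℝ))
      (Eventually.of_forall fun s => aestronglyMeasurable_du hu hX s)
      (Eventually.of_forall fun s => Eventually.of_forall fun _ => norm_du_le hu hLip _)
      (integrable_const _) (Eventually.of_forall fun ω => hc.comp (hl (X ω)))
    simpa using this
  have hlow : ∃ t : ℝ, ∫ ω, du u (-X ω - t) ∂P ≤ 1 := by
    obtain ⟨a, ha⟩ := hu.exists_du_lt_one
    have h1 := lim atTop atBot _ (tendsto_atBot_ciInf (du_mono hu.convex) hbb) fun x => by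
      simpa [sub_eq_add_neg] using
        tendsto_atBot_add_const_left atTop (-x) tendsto_neg_atTop_atBot
    obtain ⟨t, ht⟩ := (h1.eventually (gt_mem_nhds ((ciInf_le hbb a).trans_lt ha))).exists
    exact ⟨t, ht.le⟩
  have hhigh : ∃ t : ℝ, 1 ≤ ∫ ω, du u (-X ω - t) ∂P := by
    obtain ⟨b, hb⟩ := hu.exists_one_lt_du
    have h1 := lim atBot atTop _ (tendsto_atTop_ciSup (du_mono hu.convex) hba) fun x => by
      simpa [sub_eq_add_neg] using
        tendsto_atTop_add_const_left atBot (-x) tendsto_neg_atBot_atTop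
    obtain ⟨t, ht⟩ := (h1.eventually (lt_mem_nhds (hb.trans_le (le_ciSup hba b)))).exists
    exact ⟨t, ht.le⟩
  obtain ⟨s, hs⟩ := hlow
  obtain ⟨t, ht⟩ := hhigh
  exact mem_range_of_exists_le_of_exists_ge hcont ⟨s, hs⟩ ⟨t, ht⟩

theorem integrable_utility [IsProbabilityMeasure P] {u : ℝ → ℝ} {L : ℝ≥0}
    (hLip : LipschitzWith L u) {X : Ω → ℝ} (hX : Integrable X P) (t : ℝ) :
    Integrable (fun ω => u (-X ω - t)) P := by
  refine Integrable.mono' (g := fun ω => L * |X ω| + |u (-t)|)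
    ((hX.abs.const_mul _).add (integrable_const _)) ?_ (Eventually.of_forall fun ω => ?_)
  · exact (hLip.continuous.measurable.comp_aemeasurable
      (hX.aemeasurable.neg.sub_const t)).aestronglyMeasurable
  · have h := abs_sub_le_of_lipschitz hLip (-X ω - t) (-t)
    rw [show -X ω - t - -t = -X ω by ring, abs_neg] at h
    have h2 := abs_sub_abs_le_abs_sub (u (-X ω - t)) (u (-t))
    rw [Real.norm_eq_abs]
    linarith

/-- A solution of the first order condition attains the infimum. -/
theorem oce_eq_of_integral_du_eq_one [IsProbabilityMeasure P] {u : ℝ → ℝ} (hu : IsUtility u)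
    {L : ℝ≥0} (hLip : LipschitzWith L u) {X : Ω → ℝ} (hX : Integrable X P) {t : ℝ}
    (ht : ∫ ω, du u (-X ω - t) ∂P = 1) : oce u P X = t + ∫ ω, u (-X ω - t) ∂P := by
  have hint := fun s => integrable_utility hLip hX s
  refine le_antisymm (ciInf_le (bddBelow_oce hu P hX hint) t) (le_ciInf fun s => ?_)
  have hi := (integrable_du hu hLip hX.aemeasurable t).mul_const (t - s)
  have h := integral_mono ((hint t).add hi) (hint s) fun ω => by
    have := du_supports hu.convex (-X ω - t) (-X ω - s)
    change u (-X ω - t) + du u (-X ω - t) * (t - s) ≤ u (-X ω - s)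
    linarith
  change ∫ ω, (u (-X ω - t) + du u (-X ω - t) * (t - s)) ∂P ≤ _ at h
  rw [integral_add (hint t) hi, integral_mul_const, ht] at h
  linarith

/-! ### Moments of sample averages -/

variable {X : Ω → ℝ} {m : ℕ} {Z : Fin m → Ω → ℝ}

theorem identDistrib_fun_comp {f : ℝ → ℝ} (hf : Measurable f) {Y : Ω → ℝ}
    (h : IdentDistrib Y X P P) :
    IdentDistrib (fun ω => f (Y ω)) (fun ω => f (X ω)) P P := h.comp hf

theorem memLp_avg (hident : ∀ j, IdentDistrib (Z j) X P P) {f : ℝ → ℝ} (hf : Measurable f)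
    {p : ℝ≥0∞} (hfX : MemLp (fun ω => f (X ω)) p P) :
    MemLp (fun ω => avg f fun j => Z j ω) p P := by
  have h : MemLp (fun ω => ∑ j, f (Z j ω)) p P :=
    memLp_finsetSum _ fun j _ => (identDistrib_fun_comp hf (hident j)).memLp_iff.2 hfX
  exact h.const_mul (1 / (m : ℝ))

theorem integral_avg (hm : 0 < m) (hident : ∀ j, IdentDistrib (Z j) X P P) {f : ℝ → ℝ}
    (hf : Measurable f) (hfX : Integrable (fun ω => f (X ω)) P) :
    ∫ ω, avg f (fun j => Z j ω) ∂P = ∫ ω, f (X ω) ∂P := by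
  have hm' : (0 : ℝ) < m := by exact_mod_cast hm
  simp only [avg]
  rw [integral_const_mul, integral_finsetSum _ fun j _ =>
    (identDistrib_fun_comp hf (hident j)).integrable_iff.2 hfX]
  have : ∀ j, ∫ ω, f (Z j ω) ∂P = ∫ ω, f (X ω) ∂P := fun j => (identDistrib_fun_comp hf (hident j)).integral_eq
  simp only [this, Finset.sum_const, Finset.card_univ, Fintype.card_fin, nsmul_eq_mul]
  field_simp

/-- Mean square error of a sample average. -/
theorem integral_sq_avg_sub_le [IsProbabilityMeasure P] (hm : 0 < m) (hindep : iIndepFun Z P)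
    (hident : ∀ j, IdentDistrib (Z j) X P P) {f : ℝ → ℝ} (hf : Measurable f)
    (hfX : MemLp (fun ω => f (X ω)) 2 P) :
    ∫ ω, (avg f (fun j => Z j ω) - ∫ ω, f (X ω) ∂P) ^ 2 ∂P ≤ (∫ ω, f (X ω) ^ 2 ∂P) / m := by
  have hm' : (0 : ℝ) < m := by exact_mod_cast hm
  have hmem := memLp_avg hident hf hfX
  have h1 := variance_eq_integral hmem.aemeasurable
  rw [integral_avg hm hident hf (hfX.integrable one_le_two)] at h1
  rw [← h1]
  have hid := fun j => identDistrib_fun_comp hf (hident j)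
  have h2 : Var[fun ω => avg f (fun j => Z j ω); P] = (1 / (m : ℝ)) ^ 2 *
      Var[∑ j, fun ω => f (Z j ω); P] := by
    rw [← variance_const_mul]
    congr 1
    funext ω
    simp [avg]
  rw [h2, IndepFun.variance_sum (fun j _ => (hid j).memLp_iff.2 hfX)
    fun i _ j _ hij => (hindep.indepFun hij).comp hf hf]
  have h3 : ∀ j, Var[fun ω => f (Z j ω); P] = Var[fun ω => f (X ω); P] :=
    fun j => (hid j).variance_eq
  simp only [h3, Finset.sum_const, Finset.card_univ, Fintype.card_fin, nsmul_eq_mul]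
  have h4 : Var[fun ω => f (X ω); P] ≤ ∫ ω, f (X ω) ^ 2 ∂P :=
    variance_le_expectation_sq hfX.aestronglyMeasurable
  have h5 : (1 / (m : ℝ)) ^ 2 * (m * Var[fun ω => f (X ω); P]) = Var[fun ω => f (X ω); P] / m := by
    field_simp
  rw [h5]
  gcongr

/-- Mean square error of the square root of a nonnegative sample average. -/
theorem integral_sq_sqrt_avg_sub_le [IsProbabilityMeasure P] (hm : 0 < m)
    (hindep : iIndepFun Z P) (hident : ∀ j, IdentDistrib (Z j) X P P) {f : ℝ → ℝ}
    (hf : Measurable f) (hf0 : ∀ x, 0 ≤ f x) (hfX : MemLp (fun ω => f (X ω)) 2 P) {c : ℝ}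
    (hc0 : 0 ≤ c) (hc : ∀ x, f x ^ 2 ≤ c * f x) :
    Integrable (fun ω => (√(avg f fun j => Z j ω) - √(∫ ω, f (X ω) ∂P)) ^ 2) P ∧
    ∫ ω, (√(avg f fun j => Z j ω) - √(∫ ω, f (X ω) ∂P)) ^ 2 ∂P ≤ c / m := by
  have hm' : (0 : ℝ) < m := by exact_mod_cast hm
  set α := ∫ ω, f (X ω) ∂P with hα
  have hα0 : 0 ≤ α := integral_nonneg fun ω => hf0 _
  have hmem := memLp_avg hident hf hfX
  have hint : Integrable (fun ω => f (X ω)) P := hfX.integrable one_le_two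
  have hmean := integral_avg hm hident hf hint
  have hY0 : ∀ ω, 0 ≤ avg f fun j => Z j ω := fun ω => avg_nonneg hf0 _
  have hmeas : AEStronglyMeasurable (fun ω => (√(avg f fun j => Z j ω) - √α) ^ 2) P :=
    ((hmem.aemeasurable.sqrt.sub_const _).pow_const 2).aestronglyMeasurable
  have hi1 : Integrable (fun ω => (avg f fun j => Z j ω) + α) P :=
    (hmem.integrable one_le_two).add (integrable_const _)
  have hInt : Integrable (fun ω => (√(avg f fun j => Z j ω) - √α) ^ 2) P := by
    refine hi1.mono' hmeas (Eventually.of_forall fun ω => ?_)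
    rw [Real.norm_of_nonneg (sq_nonneg _)]
    nlinarith [Real.sq_sqrt (hY0 ω), Real.sq_sqrt hα0,
      mul_nonneg (Real.sqrt_nonneg (avg f fun j => Z j ω)) (Real.sqrt_nonneg α)]
  refine ⟨hInt, ?_⟩
  -- Division by α is impossible when α = 0, but then the squared root is the average itself, whose
  -- mean is 0.
  rcases hα0.eq_or_lt with h0 | h0
  · have : ∀ ω, (√(avg f fun j => Z j ω) - √α) ^ 2 = avg f fun j => Z j ω := fun ω => by
      rw [← h0, Real.sqrt_zero, sub_zero, Real.sq_sqrt (hY0 ω)]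
    simp only [this]
    rw [hmean, ← hα, ← h0]
    positivity
  · have hsq : Integrable (fun ω => ((avg f fun j => Z j ω) - α) ^ 2) P :=
      (hmem.sub (memLp_const α)).integrable_sq
    have h1 : ∫ ω, (√(avg f fun j => Z j ω) - √α) ^ 2 ∂P ≤
        ∫ ω, ((avg f fun j => Z j ω) - α) ^ 2 / α ∂P := by
      refine integral_mono hInt (hsq.div_const _) fun ω => ?_
      change (√(avg f fun j => Z j ω) - √α) ^ 2 ≤ ((avg f fun j => Z j ω) - α) ^ 2 / α
      rw [le_div_iff₀ h0]
      have e1 := Real.sq_sqrt (hY0 ω)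
      have e2 := Real.sq_sqrt hα0
      have e3 : (avg f fun j => Z j ω) - α = (√(avg f fun j => Z j ω) - √α)
        * (√(avg f fun j => Z j ω) + √α) := by linarith
      rw [e3, mul_pow]
      refine mul_le_mul_of_nonneg_left ?_ (sq_nonneg _)
      nlinarith [Real.sqrt_nonneg (avg f fun j => Z j ω), Real.sqrt_nonneg α,
        mul_nonneg (Real.sqrt_nonneg (avg f fun j => Z j ω)) (Real.sqrt_nonneg α)]
    rw [integral_div] at h1
    have h2 := integral_sq_avg_sub_le hm hindep hident hf hfX
    have h3 : ∫ ω, f (X ω) ^ 2 ∂P ≤ c * α := by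
      rw [hα, ← integral_const_mul]
      exact integral_mono hfX.integrable_sq (hint.const_mul c) fun ω => hc _
    refine h1.trans ?_
    -- The factor α in E[f²] ≤ cα cancels the division by α, so the bound c/m is free of α.
    rw [div_le_iff₀ h0]
    refine h2.trans ?_
    rw [div_mul_eq_mul_div]
    gcongr

end OCERisk

namespace OCERisk

section
variable {Ω : Type*} [MeasurableSpace Ω] {P : Measure Ω}
variable {X : Ω → ℝ} {m : ℕ} {Z : Fin m → Ω → ℝ}

/-! ### Error decomposition -/

theorem memLp_and_integral_norm_pow_le [IsProbabilityMeasure P] (hX : AEMeasurable X P) {n : ℕ}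
    (hn : n ≠ 0) {q : ℝ≥0∞} (hq : (n : ℝ≥0∞) ≤ q) {T : ℝ} (hT : 0 < T)
    (h : eLpNorm X q P ≤ ENNReal.ofReal T) :
    MemLp X n P ∧ ∫ ω, ‖X ω‖ ^ n ∂P ≤ T ^ n := by
  have h1 := (eLpNorm_le_eLpNorm_of_exponent_le hq hX.aestronglyMeasurable).trans h
  have hmem : MemLp X n P := ⟨hX.aestronglyMeasurable, h1.trans_lt ENNReal.ofReal_lt_top⟩
  refine ⟨hmem, ?_⟩
  have hn' : (n : ℝ≥0∞) ≠ 0 := by exact_mod_cast hn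
  rw [hmem.eLpNorm_eq_integral_rpow_norm hn' (ENNReal.natCast_ne_top n),
    ENNReal.ofReal_le_ofReal_iff hT.le] at h1
  simp only [ENNReal.toReal_natCast, Real.rpow_natCast] at h1
  have h0 : 0 ≤ ∫ ω, ‖X ω‖ ^ n ∂P := integral_nonneg fun ω => by positivity
  have h2 := pow_le_pow_left₀ (by positivity) h1 n
  rwa [Real.rpow_inv_natCast_pow h0 hn] at h2

theorem measurable_excess {u : ℝ → ℝ} (hu : IsUtility u) (t : ℝ) : Measurable (excess u t) :=
  (((measurable_du hu).comp (measurable_neg.sub_const t)).sub_const 1).max measurable_const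

theorem measurable_deficit {u : ℝ → ℝ} (hu : IsUtility u) (t : ℝ) : Measurable (deficit u t) :=
  (((measurable_du hu).comp (measurable_neg.sub_const t)).const_sub 1).max measurable_const

/-- The estimation error is dominated by centered sample averages with controlled moments. -/
theorem exists_error_bound [IsProbabilityMeasure P] {u : ℝ → ℝ} (hu : IsUtility u) {L : ℝ≥0}
    (hLip : LipschitzWith L u) (hX2 : MemLp X 2 P)
    (hreg : ContDiff ℝ 1 u ∨ Continuous (cdf (P.map X))) (hm : 0 < m) (hindep : iIndepFun Z P)
    (hident : ∀ j, IdentDistrib (Z j) X P P) {T : ℝ} (hT : ∫ ω, X ω ^ 2 ∂P ≤ T ^ 2) :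
    ∃ Y V R D : Ω → ℝ,
      (∀ ω, |saaOCE u (fun j => Z j ω) - oce u P X| ≤ |Y ω| + |V ω| +
        2 * (√L * √(avg (fun x => x ^ 2) fun j => Z j ω)) * |R ω|) ∧
      (Integrable (fun ω => Y ω ^ 2) P ∧ ∫ ω, Y ω ^ 2 ∂P ≤ L ^ 2 * T ^ 2 / m) ∧
      (Integrable (fun ω => V ω ^ 2) P ∧ ∫ ω, V ω ^ 2 ∂P ≤ L ^ 2 * T ^ 2 / m) ∧
      (Integrable (fun ω => R ω ^ 2) P ∧ ∫ ω, R ω ^ 2 ∂P ≤ 2 * L / m) ∧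
      (Integrable (fun ω => D ω ^ 2) P ∧ ∫ ω, D ω ^ 2 ∂P ≤ L ^ 2 / m) ∧
      ∀ ω, R ω ^ 2 ≤ |D ω| := by
  have hm' : (0 : ℝ) < m := by exact_mod_cast hm
  have hL := one_lt_lipschitz_const hu hLip
  have hX := hX2.aemeasurable
  have hXi : Integrable X P := hX2.integrable one_le_two
  obtain ⟨y₀, hmin, hup, hdown⟩ := exists_minimizer hu
  obtain ⟨t, ht⟩ := exists_integral_du_eq_one hu hLip hX hreg
  have hoce := oce_eq_of_integral_du_eq_one hu hLip hXi ht
  have hAm := measurable_excess hu t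
  have hBm := measurable_deficit hu t
  have bounded : ∀ f : ℝ → ℝ, Measurable f → (∀ x, 0 ≤ f x) → (∀ x, f x ^ 2 ≤ L * f x) →
      MemLp (fun ω => f (X ω)) 2 P := fun f hf h0 h =>
    MemLp.of_bound (hf.comp_aemeasurable hX).aestronglyMeasurable L <|
      Eventually.of_forall fun ω => by
        rw [Real.norm_of_nonneg (h0 _)]
        rcases (h0 (X ω)).eq_or_lt with h1 | h1
        · rw [← h1]; exact L.coe_nonneg
        · have := h (X ω)
          rw [sq] at this
          exact le_of_mul_le_mul_right this h1
  have hA2 := bounded _ hAm (excess_nonneg u t) fun x => (excess_sq_le hu hLip t x).trans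
    (by nlinarith [excess_nonneg u t x])
  have hB2 := bounded _ hBm (deficit_nonneg u t) fun x => (deficit_sq_le hu t x).trans
    (by nlinarith [deficit_nonneg u t x])
  have hAi : Integrable (fun ω => excess u t (X ω)) P := hA2.integrable one_le_two
  have hBi : Integrable (fun ω => deficit u t (X ω)) P := hB2.integrable one_le_two
  set α := ∫ ω, excess u t (X ω) ∂P with hα
  have hD0 : ∫ ω, (excess u t (X ω) - deficit u t (X ω)) ∂P = 0 := by
    simp only [excess_sub_deficit]
    rw [integral_sub (integrable_du hu hLip hX t) (integrable_const _), ht]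
    simp
  have hαB : ∫ ω, deficit u t (X ω) ∂P = α := by
    rw [integral_sub hAi hBi] at hD0
    linarith
  have hα0 : 0 ≤ α := integral_nonneg fun ω => excess_nonneg u t _
  have hα1 : α ≤ 1 := by
    rw [← hαB]
    refine (integral_mono hBi (integrable_const (1 : ℝ)) fun ω => ?_).trans (by simp)
    exact max_le (by linarith [du_nonneg hu (-X ω - t)]) zero_le_one
  -- The sign of t+y₀ decides whether the excess or the deficit is supported on |x| ≥ |t+y₀|. Either
  -- one serves, as both have mean α.
  have hαs : α * (t + y₀) ^ 2 ≤ L * T ^ 2 := by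
    have hXX : ∫ ω, L * X ω ^ 2 ∂P ≤ L * T ^ 2 := by
      rw [integral_const_mul]
      exact mul_le_mul_of_nonneg_left hT L.coe_nonneg
    have hXint : Integrable (fun ω => L * X ω ^ 2) P := hX2.integrable_sq.const_mul _
    refine le_trans ?_ hXX
    rcases le_total 0 (t + y₀) with hs | hs
    · rw [hα, ← integral_mul_const]
      exact integral_mono (hAi.mul_const _) hXint fun ω => excess_mul_sq_le hu hLip hup hs _
    · rw [← hαB, ← integral_mul_const]
      exact integral_mono (hBi.mul_const _) hXint fun ω => deficit_mul_sq_le hu hLip hdown hs _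
  -- Subtracting u(-t) does not change the centered average and gives |f(x)| ≤ L|x|, hence a second
  -- moment bound in T alone.
  set f : ℝ → ℝ := fun x => u (-x - t) - u (-t) with hf
  have hfm : Measurable f :=
    (hLip.continuous.measurable.comp (measurable_neg.sub_const t)).sub_const _
  have hfle : ∀ x, |f x| ≤ L * |x| := fun x => by
    have h := abs_sub_le_of_lipschitz hLip (-x - t) (-t)
    rwa [show -x - t - -t = -x by ring, abs_neg] at h
  have hf2 : MemLp (fun ω => f (X ω)) 2 P :=
    MemLp.of_le_mul (c := L) hX2 (hfm.comp_aemeasurable hX).aestronglyMeasurable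
      (Eventually.of_forall fun ω => hfle _)
  have hdm : Measurable fun x => excess u t x - deficit u t x := hAm.sub hBm
  have hd2 : MemLp (fun ω => excess u t (X ω) - deficit u t (X ω)) 2 P := hA2.sub hB2
  set b : Ω → ℝ := fun ω => avg (excess u t) fun j => Z j ω with hb
  set a : Ω → ℝ := fun ω => avg (deficit u t) fun j => Z j ω with ha
  have hb0 : ∀ ω, 0 ≤ b ω := fun ω => avg_nonneg (excess_nonneg u t) _
  have ha0 : ∀ ω, 0 ≤ a ω := fun ω => avg_nonneg (deficit_nonneg u t) _
  have hDint : Integrable (fun ω => (b ω - a ω) ^ 2) P :=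
    ((memLp_avg hident hAm hA2).sub (memLp_avg hident hBm hB2)).integrable_sq
  have hDle : ∫ ω, (b ω - a ω) ^ 2 ∂P ≤ L * α / m := by
    have h := integral_sq_avg_sub_le hm hindep hident hdm hd2
    simp only [hD0, avg_sub, sub_zero] at h
    refine h.trans ?_
    gcongr
    have h1 : ∫ ω, ((L - 1) * excess u t (X ω) + deficit u t (X ω)) ∂P = L * α := by
      rw [integral_add (hAi.const_mul _) hBi, integral_const_mul, hαB]
      ring
    rw [← h1]
    refine integral_mono hd2.integrable_sq ((hAi.const_mul _).add hBi) fun ω => ?_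
    have e1 := excess_sq_le hu hLip t (X ω)
    have e2 := deficit_sq_le hu t (X ω)
    have e3 := mul_nonneg (excess_nonneg u t (X ω)) (deficit_nonneg u t (X ω))
    change (excess u t (X ω) - deficit u t (X ω)) ^ 2
      ≤ (L - 1) * excess u t (X ω) + deficit u t (X ω)
    nlinarith
  obtain ⟨hRb, hRb'⟩ := integral_sq_sqrt_avg_sub_le hm hindep hident hAm (excess_nonneg u t) hA2
    (by linarith) (excess_sq_le hu hLip t)
  obtain ⟨hRa, hRa'⟩ := integral_sq_sqrt_avg_sub_le hm hindep hident hBm (deficit_nonneg u t) hB2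
    zero_le_one (fun x => (deficit_sq_le hu t x).trans_eq (one_mul _).symm)
  rw [hαB] at hRa hRa'
  have hRle : ∀ ω, (√(b ω) - √(a ω)) ^ 2 ≤ 2 * (√(b ω) - √α) ^ 2 + 2 * (√(a ω) - √α) ^ 2 :=
    fun ω => by nlinarith [sq_nonneg (√(b ω) - √α + (√(a ω) - √α))]
  have hRdom : Integrable (fun ω => 2 * (√(b ω) - √α) ^ 2 + 2 * (√(a ω) - √α) ^ 2) P :=
    (hRb.const_mul 2).add (hRa.const_mul 2)
  have hRint : Integrable (fun ω => (√(b ω) - √(a ω)) ^ 2) P := by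
    refine hRdom.mono' ?_ (Eventually.of_forall fun ω => ?_)
    · exact (((memLp_avg hident hAm hA2).aemeasurable.sqrt.sub
        (memLp_avg hident hBm hB2).aemeasurable.sqrt).pow_const 2).aestronglyMeasurable
    · rw [Real.norm_of_nonneg (sq_nonneg _)]
      exact hRle ω
  -- `Y` is the fluctuation of the objective at `t`; `V` and `R` carry the two gap terms, and `D`
  -- controls the square of `R`.
  refine ⟨fun ω => avg f (fun j => Z j ω) - ∫ ω, f (X ω) ∂P, fun ω => (b ω - a ω) * (t + y₀),
    fun ω => √(b ω) - √(a ω), fun ω => b ω - a ω, fun ω => ?_, ⟨?_, ?_⟩, ⟨?_, ?_⟩, ⟨hRint, ?_⟩,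
    ⟨hDint, ?_⟩, fun ω => ?_⟩
  · have hgap := sample_gap_le hu hLip hmin hm (fun j => Z j ω) t
    have hle : saaOCE u (fun j => Z j ω) ≤ t + avg (fun x => u (-x - t)) fun j => Z j ω :=
      saaOCE_le hu hm _ t
    have e1 : avg f (fun j => Z j ω) = avg (fun x => u (-x - t)) (fun j => Z j ω) - u (-t) := by
      rw [hf, avg_sub, avg_const hm]
    have e2 : ∫ ω, f (X ω) ∂P = (∫ ω, u (-X ω - t) ∂P) - u (-t) := by
      simp only [hf]
      rw [integral_sub (integrable_utility hLip hXi t) (integrable_const _)]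
      simp
    have e3 : avg f (fun j => Z j ω) - ∫ ω, f (X ω) ∂P =
        t + avg (fun x => u (-x - t)) (fun j => Z j ω) - oce u P X := by
      rw [e1, e2, hoce]; ring
    simp only [e3, abs_mul]
    have h1 := neg_abs_le (t + avg (fun x => u (-x - t)) (fun j => Z j ω) - oce u P X)
    have h2 := le_abs_self (t + avg (fun x => u (-x - t)) (fun j => Z j ω) - oce u P X)
    have h3 : 0 ≤ |b ω - a ω| * |t + y₀| := by positivity
    have h4 : 0 ≤ 2 * (√L * √(avg (fun x => x ^ 2) fun j => Z j ω)) * |√(b ω) - √(a ω)| := by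
      positivity
    rw [abs_le]
    constructor <;> linarith
  · exact ((memLp_avg hident hfm hf2).sub (memLp_const _)).integrable_sq
  · refine (integral_sq_avg_sub_le hm hindep hident hfm hf2).trans ?_
    gcongr
    have h1 : ∫ ω, L ^ 2 * X ω ^ 2 ∂P ≤ L ^ 2 * T ^ 2 := by
      rw [integral_const_mul]
      exact mul_le_mul_of_nonneg_left hT (sq_nonneg _)
    refine (integral_mono hf2.integrable_sq (hX2.integrable_sq.const_mul _) fun ω => ?_).trans h1
    have h2 := pow_le_pow_left₀ (abs_nonneg _) (hfle (X ω)) 2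
    rwa [sq_abs, mul_pow, sq_abs] at h2
  · simp only [mul_pow]
    exact hDint.mul_const _
  · simp only [mul_pow]
    rw [integral_mul_const]
    calc _ ≤ L * α / m * (t + y₀) ^ 2 := by gcongr
      _ = L * (α * (t + y₀) ^ 2) / m := by ring
      _ ≤ L * (L * T ^ 2) / m := by gcongr
      _ = L ^ 2 * T ^ 2 / m := by ring
  · refine (integral_mono hRint hRdom hRle).trans ?_
    rw [integral_add (hRb.const_mul 2) (hRa.const_mul 2), integral_const_mul, integral_const_mul]
    have : (2 * L / m : ℝ) = 2 * ((L - 1) / m) + 2 * (1 / m) := by ring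
    rw [this]
    gcongr
  · refine hDle.trans ?_
    gcongr
    nlinarith
  · have e1 := Real.sq_sqrt (hb0 ω)
    have e2 := Real.sq_sqrt (ha0 ω)
    have e3 : b ω - a ω = (√(b ω) - √(a ω)) * (√(b ω) + √(a ω)) := by linarith
    change (√(b ω) - √(a ω)) ^ 2 ≤ |b ω - a ω|
    rw [e3, abs_mul, ← sq_abs, sq]
    refine mul_le_mul_of_nonneg_left ?_ (abs_nonneg _)
    rw [abs_of_nonneg (by positivity : 0 ≤ √(b ω) + √(a ω)), abs_le]
    constructor <;> linarith [Real.sqrt_nonneg (b ω), Real.sqrt_nonneg (a ω)]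

theorem aemeasurable_saaOCE {u : ℝ → ℝ} (hu : IsUtility u) {L : ℝ≥0} (hLip : LipschitzWith L u)
    (hm : 0 < m) (hident : ∀ j, IdentDistrib (Z j) X P P) :
    AEMeasurable (fun ω => saaOCE u fun j => Z j ω) P :=
  (continuous_saaOCE hu hLip hm).measurable.comp_aemeasurable
    (aemeasurable_pi_lambda _ fun j => (hident j).aemeasurable_fst)

/-! ### First and second moments of the error -/

theorem mean_abs_error_le [IsProbabilityMeasure P] {u : ℝ → ℝ} (hu : IsUtility u) {L : ℝ≥0}
    (hLip : LipschitzWith L u) (hX2 : MemLp X 2 P)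
    (hreg : ContDiff ℝ 1 u ∨ Continuous (cdf (P.map X))) (hm : 0 < m) (hindep : iIndepFun Z P)
    (hident : ∀ j, IdentDistrib (Z j) X P P) {T : ℝ} (hT0 : 0 < T)
    (hT : ∫ ω, X ω ^ 2 ∂P ≤ T ^ 2) :
    Integrable (fun ω => |saaOCE u (fun j => Z j ω) - oce u P X|) P ∧
      ∫ ω, |saaOCE u (fun j => Z j ω) - oce u P X| ∂P ≤ 5 * (L * T / √(m : ℝ)) := by
  obtain ⟨Y, V, R, D, hle, ⟨hY, hY'⟩, ⟨hV, hV'⟩, ⟨hR, hR'⟩, -, -⟩ :=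
    exists_error_bound hu hLip hX2 hreg hm hindep hident hT
  have hm' : (0 : ℝ) < m := by exact_mod_cast hm
  have hL0 : (0 : ℝ) < L := one_pos.trans (one_lt_lipschitz_const hu hLip)
  have hrm : 0 < √(m : ℝ) := Real.sqrt_pos.2 hm'
  have hrm2 : √(m : ℝ) ^ 2 = m := Real.sq_sqrt hm'.le
  set S : Ω → ℝ := fun ω => avg (fun x => x ^ 2) fun j => Z j ω with hS
  have hS0 : ∀ ω, 0 ≤ S ω := fun ω => avg_nonneg (fun x => sq_nonneg x) _
  have hsqm : Measurable fun x : ℝ => x ^ 2 := measurable_id.pow_const 2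
  have hSint : Integrable S P :=
    memLp_one_iff_integrable.1 (memLp_avg hident hsqm (memLp_one_iff_integrable.2 hX2.integrable_sq))
  have hSle : ∫ ω, S ω ∂P ≤ T ^ 2 :=
    (integral_avg hm hident hsqm hX2.integrable_sq).trans_le hT
  set c : ℝ := L * T / √(m : ℝ) with hc
  -- This AM-GM weight balances L S/k, of mean at most c, against k R², of mean at most 2c. With 2c
  -- from `Y` and `V` the total is 5c.
  set k : ℝ := √(m : ℝ) * T with hk
  have hc0 : 0 < c := by positivity
  have hk0 : 0 < k := by positivity
  have amgm : ∀ y : ℝ, |y| ≤ (2 * c)⁻¹ * y ^ 2 + c / 2 := fun y => by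
    have : (2 * c)⁻¹ * y ^ 2 + c / 2 - |y| = (2 * c)⁻¹ * (|y| - c) ^ 2 := by
      rw [← sq_abs y]; field_simp; ring
    nlinarith [mul_nonneg (inv_nonneg.2 (by positivity : 0 ≤ 2 * c)) (sq_nonneg (|y| - c))]
  have hdom : ∀ ω, |saaOCE u (fun j => Z j ω) - oce u P X| ≤
      ((2 * c)⁻¹ * Y ω ^ 2 + (2 * c)⁻¹ * V ω ^ 2) + (L / k * S ω + k * R ω ^ 2) + c := fun ω => by
    have h1 : 2 * (√L * √(S ω)) * |R ω| ≤ L / k * S ω + k * R ω ^ 2 := by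
      have e1 := Real.sq_sqrt L.coe_nonneg
      have e2 := Real.sq_sqrt (hS0 ω)
      have : L / k * S ω + k * R ω ^ 2 - 2 * (√L * √(S ω)) * |R ω|
          = k⁻¹ * (√L * √(S ω) - k * |R ω|) ^ 2 := by
        rw [sub_sq, mul_pow, e1, e2, mul_pow, sq_abs]; field_simp; ring
      nlinarith [mul_nonneg (inv_nonneg.2 hk0.le) (sq_nonneg (√L * √(S ω) - k * |R ω|))]
    linarith [hle ω, amgm (Y ω), amgm (V ω)]
  have hYV : Integrable (fun ω => (2 * c)⁻¹ * Y ω ^ 2 + (2 * c)⁻¹ * V ω ^ 2) P :=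
    (hY.const_mul (2 * c)⁻¹).add (hV.const_mul (2 * c)⁻¹)
  have hSR : Integrable (fun ω => L / k * S ω + k * R ω ^ 2) P :=
    (hSint.const_mul (L / k)).add (hR.const_mul k)
  have hYVSR : Integrable (fun ω => ((2 * c)⁻¹ * Y ω ^ 2 + (2 * c)⁻¹ * V ω ^ 2)
    + (L / k * S ω + k * R ω ^ 2)) P := hYV.add hSR
  have hdi : Integrable (fun ω => ((2 * c)⁻¹ * Y ω ^ 2 + (2 * c)⁻¹ * V ω ^ 2)
    + (L / k * S ω + k * R ω ^ 2) + c) P := hYVSR.add (integrable_const c)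
  have hint : Integrable (fun ω => |saaOCE u (fun j => Z j ω) - oce u P X|) P :=
    hdi.mono' (((aemeasurable_saaOCE hu hLip hm hident).sub_const _).abs).aestronglyMeasurable
      (Eventually.of_forall fun ω => by rw [Real.norm_of_nonneg (abs_nonneg _)]; exact hdom ω)
  refine ⟨hint, (integral_mono hint hdi hdom).trans ?_⟩
  rw [integral_add hYVSR (integrable_const c), integral_add hYV hSR,
    integral_add (hY.const_mul (2 * c)⁻¹) (hV.const_mul (2 * c)⁻¹),
    integral_add (hSint.const_mul (L / k)) (hR.const_mul k)]
  simp only [integral_const_mul, integral_const, probReal_univ, one_smul]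
  have hcc : L ^ 2 * T ^ 2 / m = c ^ 2 := by rw [hc, div_pow, mul_pow, hrm2]
  rw [hcc] at hY' hV'
  have b1 : (2 * c)⁻¹ * ∫ ω, Y ω ^ 2 ∂P ≤ c / 2 := by
    refine (mul_le_mul_of_nonneg_left hY' (by positivity)).trans_eq ?_
    field_simp
  have b2 : (2 * c)⁻¹ * ∫ ω, V ω ^ 2 ∂P ≤ c / 2 := by
    refine (mul_le_mul_of_nonneg_left hV' (by positivity)).trans_eq ?_
    field_simp
  have b3 : L / k * ∫ ω, S ω ∂P ≤ c := by
    refine (mul_le_mul_of_nonneg_left hSle (by positivity)).trans_eq ?_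
    rw [hc, hk]; field_simp
  have b4 : k * ∫ ω, R ω ^ 2 ∂P ≤ 2 * c := by
    refine (mul_le_mul_of_nonneg_left hR' hk0.le).trans_eq ?_
    rw [hc, hk]; field_simp; rw [hrm2]
  linarith

theorem mean_sq_error_le [IsProbabilityMeasure P] {u : ℝ → ℝ} (hu : IsUtility u) {L : ℝ≥0}
    (hLip : LipschitzWith L u) (hX4 : MemLp X 4 P)
    (hreg : ContDiff ℝ 1 u ∨ Continuous (cdf (P.map X))) (hm : 0 < m) (hindep : iIndepFun Z P)
    (hident : ∀ j, IdentDistrib (Z j) X P P) {T : ℝ} (hT0 : 0 < T)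
    (hT : ∫ ω, X ω ^ 2 ∂P ≤ T ^ 2) (hT4 : ∫ ω, X ω ^ 4 ∂P ≤ T ^ 4) :
    Integrable (fun ω => |saaOCE u (fun j => Z j ω) - oce u P X| ^ 2) P ∧
      ∫ ω, |saaOCE u (fun j => Z j ω) - oce u P X| ^ 2 ∂P
        ≤ 18 * (L ^ 2 * T ^ 2 / √(m : ℝ)) := by
  have hX2 : MemLp X 2 P := hX4.mono_exponent (by norm_num)
  obtain ⟨Y, V, R, D, hle, ⟨hY, hY'⟩, ⟨hV, hV'⟩, -, ⟨hD, hD'⟩, hRD⟩ :=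
    exists_error_bound hu hLip hX2 hreg hm hindep hident hT
  have hm' : (0 : ℝ) < m := by exact_mod_cast hm
  have hL0 : (0 : ℝ) < L := one_pos.trans (one_lt_lipschitz_const hu hLip)
  have hrm : 0 < √(m : ℝ) := Real.sqrt_pos.2 hm'
  have hrm2 : √(m : ℝ) ^ 2 = m := Real.sq_sqrt hm'.le
  set S : Ω → ℝ := fun ω => avg (fun x => x ^ 2) fun j => Z j ω with hS
  set F : Ω → ℝ := fun ω => avg (fun x => x ^ 4) fun j => Z j ω with hF
  have hS0 : ∀ ω, 0 ≤ S ω := fun ω => avg_nonneg (fun x => sq_nonneg x) _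
  have hSF : ∀ ω, S ω ^ 2 ≤ F ω := fun ω => by
    have := avg_mul_sq_le (fun x => x ^ 2) (fun _ => 1) fun j => Z j ω
    simp only [mul_one, one_pow, avg_const hm, ← pow_mul] at this
    exact this
  have h4m : Measurable fun x : ℝ => x ^ 4 := measurable_id.pow_const 4
  have hX4i : Integrable (fun ω => X ω ^ 4) P := by
    have := hX4.integrable_norm_pow (p := 4) (by norm_num)
    refine this.congr (Eventually.of_forall fun ω => ?_)
    change ‖X ω‖ ^ 4 = X ω ^ 4
    rw [Real.norm_eq_abs, (by decide : Even 4).pow_abs]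
  have hFint : Integrable F P :=
    memLp_one_iff_integrable.1 (memLp_avg hident h4m (memLp_one_iff_integrable.2 hX4i))
  have hFle : ∫ ω, F ω ∂P ≤ T ^ 4 := (integral_avg hm hident h4m hX4i).trans_le hT4
  set c : ℝ := L ^ 2 * T ^ 2 / √(m : ℝ) with hc
  -- This weight makes the terms in F and D² contribute at most 6c each. With 3c each from `Y` and
  -- `V` the total is 18c.
  set k : ℝ := L / (T ^ 2 * √(m : ℝ)) with hk
  have hc0 : 0 < c := by positivity
  have hk0 : 0 < k := by positivity
  have hdom : ∀ ω, |saaOCE u (fun j => Z j ω) - oce u P X| ^ 2 ≤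
      (3 * Y ω ^ 2 + 3 * V ω ^ 2) + (6 * L * k * F ω + 6 * L / k * D ω ^ 2) := fun ω => by
    have e1 := Real.sq_sqrt L.coe_nonneg
    have e2 := Real.sq_sqrt (hS0 ω)
    have h1 : (2 * (√L * √(S ω)) * |R ω|) ^ 2 ≤ 2 * L * k * F ω + 2 * L / k * D ω ^ 2 := by
      have h2 : (2 * (√L * √(S ω)) * |R ω|) ^ 2 = 4 * L * S ω * R ω ^ 2 := by
        rw [mul_pow, mul_pow, mul_pow, e1, e2, sq_abs]; ring
      -- Replacing R² by |D| costs the rate 1/m but leaves a product S|D| that needs only fourth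
      -- moments of X.
      have h3 : 4 * L * S ω * R ω ^ 2 ≤ 4 * L * S ω * |D ω| :=
        mul_le_mul_of_nonneg_left (hRD ω) (by have := hS0 ω; positivity)
      have h4 : 2 * L * k * S ω ^ 2 + 2 * L / k * D ω ^ 2 - 4 * L * S ω * |D ω|
          = 2 * L / k * (k * S ω - |D ω|) ^ 2 := by
        rw [← sq_abs (D ω)]; field_simp; ring
      have h5 : 0 ≤ 2 * L / k * (k * S ω - |D ω|) ^ 2 := by positivity
      have h6 : 2 * L * k * S ω ^ 2 ≤ 2 * L * k * F ω :=
        mul_le_mul_of_nonneg_left (hSF ω) (by positivity)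
      linarith
    have h7 := pow_le_pow_left₀ (abs_nonneg _) (hle ω) 2
    have h8 : ∀ x y z : ℝ, (x + y + z) ^ 2 ≤ 3 * x ^ 2 + 3 * y ^ 2 + 3 * z ^ 2 := fun x y z => by
      nlinarith [sq_nonneg (x - y), sq_nonneg (x - z), sq_nonneg (y - z)]
    have h9 := h8 |Y ω| |V ω| (2 * (√L * √(S ω)) * |R ω|)
    rw [sq_abs, sq_abs] at h9
    refine (h7.trans h9).trans ?_
    have h10 : 3 * (2 * L * k * F ω + 2 * L / k * D ω ^ 2)
        = 6 * L * k * F ω + 6 * L / k * D ω ^ 2 := by ring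
    linarith
  have hYV : Integrable (fun ω => 3 * Y ω ^ 2 + 3 * V ω ^ 2) P :=
    (hY.const_mul 3).add (hV.const_mul 3)
  have hFD : Integrable (fun ω => 6 * L * k * F ω + 6 * L / k * D ω ^ 2) P :=
    (hFint.const_mul (6 * L * k)).add (hD.const_mul (6 * L / k))
  have hdi : Integrable (fun ω => (3 * Y ω ^ 2 + 3 * V ω ^ 2)
    + (6 * L * k * F ω + 6 * L / k * D ω ^ 2)) P := hYV.add hFD
  have hint : Integrable (fun ω => |saaOCE u (fun j => Z j ω) - oce u P X| ^ 2) P :=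
    hdi.mono'
      ((((aemeasurable_saaOCE hu hLip hm hident).sub_const _).abs).pow_const 2).aestronglyMeasurable
      (Eventually.of_forall fun ω => by rw [Real.norm_of_nonneg (sq_nonneg _)]; exact hdom ω)
  refine ⟨hint, (integral_mono hint hdi hdom).trans ?_⟩
  rw [integral_add hYV hFD, integral_add (hY.const_mul 3) (hV.const_mul 3),
    integral_add (hFint.const_mul (6 * L * k)) (hD.const_mul (6 * L / k))]
  simp only [integral_const_mul]
  have hcc : L ^ 2 * T ^ 2 / m ≤ c := by
    rw [hc]
    gcongr
    rw [Real.sqrt_le_left hm'.le]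
    have : (1 : ℝ) ≤ m := by exact_mod_cast hm
    nlinarith
  have b3 : 6 * L * k * ∫ ω, F ω ∂P ≤ 6 * c := by
    refine (mul_le_mul_of_nonneg_left hFle (by positivity)).trans_eq ?_
    rw [hc, hk]; field_simp
  have b4 : 6 * L / k * ∫ ω, D ω ^ 2 ∂P ≤ 6 * c := by
    refine (mul_le_mul_of_nonneg_left hD' (by positivity)).trans_eq ?_
    rw [hc, hk]; field_simp; rw [hrm2]
  linarith

end

end OCERisk

/-! ### The theorem, with constants 5 ≤ 39 and 18 ≤ 108 -/

theorem mainTheorem7 {Ω : Type*} [MeasurableSpace Ω] (P : Measure Ω) [IsProbabilityMeasure P]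
    (u : ℝ → ℝ) (hu : OCERisk.IsUtility u) (L₂ : ℝ≥0) (hLip : LipschitzWith L₂ u)
    (X : Ω → ℝ) (hX : AEMeasurable X P)
    (hreg : ContDiff ℝ 1 u ∨ Continuous (cdf (P.map X)))
    (m : ℕ) (hm : 0 < m) (Z : Fin m → Ω → ℝ)
    (hindep : iIndepFun Z P) (hident : ∀ j, IdentDistrib (Z j) X P P) :
    (∀ (q : ℝ≥0∞) (T : ℝ), 2 < q → 0 < T → eLpNorm X q P ≤ ENNReal.ofReal T →
      Integrable (fun ω => |OCERisk.saaOCE u (fun j => Z j ω) - OCERisk.oce u P X|) P ∧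
      ∫ ω, |OCERisk.saaOCE u (fun j => Z j ω) - OCERisk.oce u P X| ∂P
        ≤ 39 * L₂ * T / √(m : ℝ)) ∧
    (∀ (q : ℝ≥0∞) (T : ℝ), 4 < q → 0 < T → eLpNorm X q P ≤ ENNReal.ofReal T →
      Integrable (fun ω => |OCERisk.saaOCE u (fun j => Z j ω) - OCERisk.oce u P X| ^ 2) P ∧
      ∫ ω, |OCERisk.saaOCE u (fun j => Z j ω) - OCERisk.oce u P X| ^ 2 ∂P
        ≤ 108 * (L₂ : ℝ) ^ 2 * T ^ 2 / √(m : ℝ)) := by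
  have moment : ∀ (n : ℕ) (q : ℝ≥0∞) (T : ℝ), Even n → n ≠ 0 → (n : ℝ≥0∞) ≤ q → 0 < T →
      eLpNorm X q P ≤ ENNReal.ofReal T → MemLp X n P ∧ ∫ ω, X ω ^ n ∂P ≤ T ^ n := by
    intro n q T hn hn0 hq hT h
    have := OCERisk.memLp_and_integral_norm_pow_le hX hn0 hq hT h
    simpa only [Real.norm_eq_abs, hn.pow_abs] using this
  refine ⟨fun q T hq hT h => ?_, fun q T hq hT h => ?_⟩
  · obtain ⟨h1, h2⟩ := moment 2 q T even_two two_ne_zero (by exact_mod_cast hq.le) hT h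
    obtain ⟨h3, h4⟩ := OCERisk.mean_abs_error_le hu hLip (by exact_mod_cast h1) hreg hm hindep
      hident hT h2
    refine ⟨h3, h4.trans ?_⟩
    have : 0 ≤ L₂ * T / √(m : ℝ) := by positivity
    rw [mul_assoc, mul_div_assoc 39]
    linarith
  · have hq2 : (2 : ℝ≥0∞) ≤ q := le_trans (by norm_num) hq.le
    obtain ⟨-, h2⟩ := moment 2 q T even_two two_ne_zero (by exact_mod_cast hq2) hT h
    obtain ⟨h1, h4⟩ := moment 4 q T (by decide) (by norm_num) (by exact_mod_cast hq.le) hT h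
    obtain ⟨h5, h6⟩ := OCERisk.mean_sq_error_le hu hLip (by exact_mod_cast h1) hreg hm hindep
      hident hT h2 h4
    refine ⟨h5, h6.trans ?_⟩
    have : 0 ≤ (L₂ : ℝ) ^ 2 * T ^ 2 / √(m : ℝ) := by positivity
    rw [mul_assoc, mul_div_assoc 108]
    linarith
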